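/- There is an absolute constant $c>0$ (independent of $n$, $\alpha$ and $\varphi$) such that the following holds for every integer $n\ge 3$, every real $\alpha<2$ with $n+\alpha-4>0$, and every real-valued $\varphi\in C_0^\infty(\mathbb{B}^n\setminus\{0\})$ (smooth with compact support in $\mathbb{B}^n\setminus\{0\}$), where $\mathbb{B}^n=\{x\in\mathbb{R}^n: |x|<1\}$ is the Poincaré ball model of hyperbolic space $\mathbb{H}^n$. Put $p(x)=\frac{2}{1-|x|^2}$, $d(x)=\log\frac{1+|x|}{1-|x|}$ (the hyperbolic distance from $x$ to the origin), $dV=p^n\,dx$ (the hyperbolic volume, with $dx$ the Lebesgue measure) and $\Delta_{\mathbb{H}}u=p^{-n}\operatorname{div}(p^{n-2}\nabla u)$ (the Laplace–Beltrami operator, with Euclidean $\operatorname{div}$ and $\nabla$). Then $$\int_{\mathbb{B}^n} d^{\alpha}\,|\Delta_{\mathbb{H}}\varphi|^2\,dV\;\ge\;\frac{(n+\alpha-4)^2(n-\alpha)^2}{16}\int_{\mathbb{B}^n} d^{\alpha-4}\varphi^2\,dV\;+\;c\,\varepsilon\,2^n\int_{\mathbb{B}^n} d^{\alpha}\varphi^2\,dx,\qquad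 \varepsilon=\frac{(n+\alpha-4)(n-\alpha)}{8}.$$ -/

import Mathlib

open MeasureTheory
open scoped ContDiff

namespace PoincareBall

noncomputable section

/-- The open Euclidean unit ball `𝔹ⁿ`, the underlying space of the Poincaré model of `ℍⁿ`. -/
def unitBall (n : ℕ) : Set (EuclideanSpace ℝ (Fin n)) := Metric.ball 0 1

/-- The conformal factor `p(x) = 2 / (1 - |x|²)` of the hyperbolic metric `p² |dx|²` on `𝔹ⁿ`. -/
def conformalFactor {n : ℕ} (x : EuclideanSpace ℝ (Fin n)) : ℝ := 2 / (1 - ‖x‖ ^ 2)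

/-- The hyperbolic distance `d(x) = log ((1 + |x|) / (1 - |x|))` from `x ∈ 𝔹ⁿ` to the origin. -/
def hypDist {n : ℕ} (x : EuclideanSpace ℝ (Fin n)) : ℝ := Real.log ((1 + ‖x‖) / (1 - ‖x‖))

/-- The hyperbolic volume `dV = pⁿ dx` on `𝔹ⁿ`, with `dx` the Lebesgue measure. -/
def hypVolume (n : ℕ) : Measure (EuclideanSpace ℝ (Fin n)) :=
  (volume.restrict (unitBall n)).withDensity (fun x => ENNReal.ofReal (conformalFactor x ^ n))

/-- The Euclidean divergence `∑ᵢ ∂ᵢ Fᵢ`. -/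
def euclDiv {n : ℕ} (F : EuclideanSpace ℝ (Fin n) → EuclideanSpace ℝ (Fin n))
    (x : EuclideanSpace ℝ (Fin n)) : ℝ :=
  ∑ i : Fin n, (fderiv ℝ F x (EuclideanSpace.single i 1)) i

/-- The Laplace-Beltrami operator of `ℍⁿ` on the ball: `Δ u = p⁻ⁿ div (pⁿ⁻² ∇u)`, with `∇` the
Euclidean gradient; the exponents are integers. -/
def hypLaplacian {n : ℕ} (u : EuclideanSpace ℝ (Fin n) → ℝ) (x : EuclideanSpace ℝ (Fin n)) : ℝ :=
  conformalFactor x ^ (-(n : ℤ)) *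
    euclDiv (fun y => conformalFactor y ^ ((n : ℤ) - 2) • gradient u y) x

end

end PoincareBall

/-! The inequality is the integral of a pointwise one whose error term is a divergence. Write `κ =
(n+α-4)(n-α)/4`, `d` for the distance and `p` for the conformal factor. Add `2κ div F`, with `F` the
compactly supported `rellichField`, to the density `pⁿ d^α |Δφ|²`. The sum is then `p^n d^(α-4) (d²
Δφ + κ φ)²`, plus `2κ p^(n-2) d^(α-4)` times the Hardy square `|d ∇φ + ((n+α-4)/2) p φ x/|x||²`,
plus multiples of `p^n d^(α-4) φ²`. Those multiples are the sharp `κ²`, and `κ (n-1)(n-2)(d coth d -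
1)`, where `coth d = (1+|x|²)/(2|x|)`.

The last term is the gain from curvature: in hyperbolic space `Δd = (n-1) coth d`, against `(n-1)/d`
in flat space. It dominates `d⁴` times the Euclidean density, by `log_pow_four_mul_le`. The squares
are handled by `rellich_algebraic_bound`, the divergence by `euclDiv_rellichField` and
`integral_euclDiv_eq_zero`. -/

namespace PoincareBall

/-! ### One-variable estimates and derivatives in the radius `s = tanh (d/2)`. -/

section Radial

theorem hasDerivAt_log_one_add_div_one_sub {s : ℝ} (h0 : 0 < s) (h1 : s < 1) :
    HasDerivAt (fun r : ℝ => Real.log ((1 + r) / (1 - r))) (2 / (1 - s ^ 2)) s := by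
  have h2 : 1 - s ≠ 0 := by linarith
  have h3 : 1 + s ≠ 0 := by linarith
  have h4 : 1 - s ^ 2 ≠ 0 := by nlinarith
  have hd := (((hasDerivAt_id s).const_add 1).div ((hasDerivAt_id s).const_sub 1) h2).log
    (div_ne_zero h3 h2)
  refine hd.congr_deriv ?_
  simp only [id, Pi.div_apply]
  field_simp
  ring

theorem hasDerivAt_two_div_one_sub_sq {s : ℝ} (h0 : 0 < s) (h1 : s < 1) :
    HasDerivAt (fun r : ℝ => 2 / (1 - r ^ 2)) (s * (2 / (1 - s ^ 2)) ^ 2) s := by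
  have h4 : 1 - s ^ 2 ≠ 0 := by nlinarith
  have hd := (hasDerivAt_const s (2 : ℝ)).div ((hasDerivAt_pow 2 s).const_sub 1) h4
  refine hd.congr_deriv ?_
  field_simp
  norm_num
  ring

theorem two_mul_le_log_one_add_div_one_sub {s : ℝ} (h0 : 0 ≤ s) (h1 : s < 1) :
    2 * s ≤ Real.log ((1 + s) / (1 - s)) := by
  have := Real.sum_range_le_log_div h0 h1 1
  simp at this
  linarith

/-- This is `t ≤ sinh t` at `t = artanh s = d/2`, squared, since `sinh (artanh s) = s / √(1 - s²)`.
-/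
theorem log_one_add_div_one_sub_sq_le {s : ℝ} (h0 : 0 ≤ s) (h1 : s < 1) :
    Real.log ((1 + s) / (1 - s)) ^ 2 * (1 - s ^ 2) ≤ 4 * s ^ 2 := by
  have hs : s ∈ Set.Ioo (-1 : ℝ) 1 := ⟨by linarith, h1⟩
  have hp : 0 < 1 - s ^ 2 := by nlinarith
  have ha := Real.artanh_eq_half_log (x := s) ⟨by linarith, h1.le⟩
  have hd : 0 ≤ Real.artanh s := by
    rw [ha]; linarith [two_mul_le_log_one_add_div_one_sub h0 h1]
  have hle := Real.self_le_sinh_iff.2 hd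
  rw [Real.sinh_artanh hs, le_div_iff₀ (Real.sqrt_pos.2 hp)] at hle
  have hsq := pow_le_pow_left₀ (by positivity) hle 2
  rw [mul_pow, Real.sq_sqrt hp.le, ha] at hsq
  linarith

/-- The comparison between `d coth d - 1` and `d⁴ (1 - s²)³`, where `d` is the hyperbolic distance
at Euclidean radius `s`. -/
theorem log_pow_four_mul_le {s : ℝ} (h0 : 0 < s) (h1 : s < 1) :
    Real.log ((1 + s) / (1 - s)) ^ 4 * (1 - s ^ 2) ^ 3 ≤
      16 * (Real.log ((1 + s) / (1 - s)) * ((1 + s ^ 2) / (2 * s)) - 1) := by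
  set d := Real.log ((1 + s) / (1 - s))
  have h2 : 2 * s ≤ d := two_mul_le_log_one_add_div_one_sub h0.le h1
  have h3 : d ^ 2 * (1 - s ^ 2) ≤ 4 * s ^ 2 := log_one_add_div_one_sub_sq_le h0.le h1
  have hp : 0 < 1 - s ^ 2 := by nlinarith
  -- Here `(1 + s²)/(2s) = coth d`, so `d ≥ 2s` already gives `d coth d ≥ 1 + s²`.
  have h4 : s ^ 2 ≤ d * ((1 + s ^ 2) / (2 * s)) - 1 := by
    have : 2 * s * ((1 + s ^ 2) / (2 * s)) ≤ d * ((1 + s ^ 2) / (2 * s)) := by gcongr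
    rw [mul_div_cancel₀ _ (by positivity)] at this
    linarith
  have h5 : (d ^ 2 * (1 - s ^ 2)) ^ 2 ≤ (4 * s ^ 2) ^ 2 := by gcongr
  calc d ^ 4 * (1 - s ^ 2) ^ 3 = (d ^ 2 * (1 - s ^ 2)) ^ 2 * (1 - s ^ 2) := by ring
    _ ≤ (4 * s ^ 2) ^ 2 * 1 := by gcongr; nlinarith
    _ ≤ 16 * s ^ 2 := by nlinarith [sq_nonneg s]
    _ ≤ _ := by linarith

/-- The radial profile `dᵝ⁺¹ pᵐ / s` of the vector field `d^(β+1) p^m x/|x|`. -/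
theorem hasDerivAt_radialProfile {s : ℝ} (h0 : 0 < s) (h1 : s < 1) (β : ℝ) (n : ℤ) :
    HasDerivAt (fun r : ℝ => Real.log ((1 + r) / (1 - r)) ^ (β + 1) * (2 / (1 - r ^ 2)) ^ (n - 1)
        * r⁻¹)
      (Real.log ((1 + s) / (1 - s)) ^ β * (2 / (1 - s ^ 2)) ^ n *
        ((β + 1) + (n - 1) * Real.log ((1 + s) / (1 - s)) * s
          - Real.log ((1 + s) / (1 - s)) * ((1 - s ^ 2) / (2 * s))) / s) s := by
  have hd : 0 < Real.log ((1 + s) / (1 - s)) := by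
    linarith [two_mul_le_log_one_add_div_one_sub h0.le h1]
  have hq : 0 < 1 - s ^ 2 := by nlinarith
  have hp : 0 < 2 / (1 - s ^ 2) := by positivity
  have h2 := (hasDerivAt_log_one_add_div_one_sub h0 h1).rpow_const (p := β + 1) (Or.inl hd.ne')
  have h3 := (hasDerivAt_zpow (n - 1) _ (Or.inl hp.ne')).comp s
    (hasDerivAt_two_div_one_sub_sq h0 h1)
  refine ((h2.mul h3).mul (hasDerivAt_inv h0.ne')).congr_deriv ?_
  have e : (1 - s ^ 2) / (2 * s) = 1 / (2 / (1 - s ^ 2) * s) := by field_simp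
  rw [e]
  simp only [Function.comp_apply, Pi.mul_apply]
  set d := Real.log ((1 + s) / (1 - s))
  set p := 2 / (1 - s ^ 2)
  have e2 : p ^ n = p ^ (n - 1 - 1) * p ^ 2 := by
    rw [← zpow_natCast p 2, ← zpow_add₀ hp.ne']; congr 1; push_cast; ring
  have e3 : p ^ (n - 1) = p ^ (n - 1 - 1) * p := by
    rw [← zpow_add_one₀ hp.ne']; congr 1; ring
  rw [e2, e3, Real.rpow_add_one hd.ne' β, add_sub_cancel_right]
  push_cast
  field_simp
  ring

end Radial

/-! ### Euclidean divergence: product rule and the divergence theorem for compact support. -/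

section Calculus

variable {n : ℕ}

theorem hasFDerivAt_comp_norm {E : Type*} [NormedAddCommGroup E] [InnerProductSpace ℝ E]
    {c : ℝ → ℝ} {c' : ℝ} {x : E} (hx : x ≠ 0) (hc : HasDerivAt c c' ‖x‖) :
    HasFDerivAt (fun y => c ‖y‖) ((c' / ‖x‖) • innerSL ℝ x) x := by
  have hn : 0 < ‖x‖ := norm_pos_iff.2 hx
  have h := ((hasStrictFDerivAt_norm_sq x).hasFDerivAt).sqrt (by positivity)
  simp only [Real.sqrt_sq (norm_nonneg _)] at h
  refine (hc.comp_hasFDerivAt x h).congr_fderiv ?_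
  ext v
  simp
  field_simp

theorem euclDiv_add {F G : EuclideanSpace ℝ (Fin n) → EuclideanSpace ℝ (Fin n)}
    {x : EuclideanSpace ℝ (Fin n)} (hF : DifferentiableAt ℝ F x) (hG : DifferentiableAt ℝ G x) :
    euclDiv (fun y => F y + G y) x = euclDiv F x + euclDiv G x := by
  simp [euclDiv, fderiv_fun_add hF hG, Finset.sum_add_distrib]

theorem euclDiv_smul {a : EuclideanSpace ℝ (Fin n) → ℝ}
    {F : EuclideanSpace ℝ (Fin n) → EuclideanSpace ℝ (Fin n)} {x : EuclideanSpace ℝ (Fin n)}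
    (ha : DifferentiableAt ℝ a x) (hF : DifferentiableAt ℝ F x) :
    euclDiv (fun y => a y • F y) x = a x * euclDiv F x + fderiv ℝ a x (F x) := by
  have hs : F x = ∑ i, F x i • EuclideanSpace.single i (1 : ℝ) := by
    ext j; simp [Pi.single_apply]
  conv_rhs => rw [hs, map_sum]
  simp [euclDiv, fderiv_fun_smul ha hF, Finset.sum_add_distrib, Finset.mul_sum, mul_comm]

theorem euclDiv_id (x : EuclideanSpace ℝ (Fin n)) : euclDiv (fun y => y) x = n := by
  simp [euclDiv]

theorem euclDiv_eq_zero_of_notMem_tsupport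
    {F : EuclideanSpace ℝ (Fin n) → EuclideanSpace ℝ (Fin n)} {x : EuclideanSpace ℝ (Fin n)}
    (hx : x ∉ tsupport F) : euclDiv F x = 0 := by
  simp [euclDiv, fderiv_of_notMem_tsupport ℝ hx]

theorem continuousOn_euclDiv {F : EuclideanSpace ℝ (Fin n) → EuclideanSpace ℝ (Fin n)}
    {U : Set (EuclideanSpace ℝ (Fin n))} (hU : IsOpen U) (hF : ContDiffOn ℝ 1 F U) :
    ContinuousOn (euclDiv F) U := by
  have h := hF.continuousOn_fderiv_of_isOpen hU le_rfl
  unfold euclDiv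
  fun_prop

theorem hasCompactSupport_euclDiv {F : EuclideanSpace ℝ (Fin n) → EuclideanSpace ℝ (Fin n)}
    (hc : HasCompactSupport F) : HasCompactSupport (euclDiv F) :=
  hc.mono' fun _ hx => by_contra fun h => hx (euclDiv_eq_zero_of_notMem_tsupport h)

theorem integral_fderiv_apply_eq_zero {E : Type*} [NormedAddCommGroup E] [NormedSpace ℝ E]
    [FiniteDimensional ℝ E] [MeasurableSpace E] [BorelSpace E] (μ : Measure E)
    [μ.IsAddHaarMeasure] {f : E → ℝ} (hf : ContDiff ℝ 1 f) (hc : HasCompactSupport f) (v : E) :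
    ∫ x, fderiv ℝ f x v ∂μ = 0 := by
  have hi : Integrable (fun x => fderiv ℝ f x v) μ :=
    ((hf.continuous_fderiv one_ne_zero).clm_apply continuous_const).integrable_of_hasCompactSupport
      (hc.fderiv_apply ℝ v)
  -- Integration by parts against the constant `1`, whose derivative vanishes.
  have h := integral_mul_fderiv_eq_neg_fderiv_mul_of_integrable (μ := μ) (f := fun _ => (1 : ℝ))
    (g := f) (v := v) (by simp) (by simpa using hi)
    (by simpa using hf.continuous.integrable_of_hasCompactSupport hc)
    (fun x _ => differentiableAt_const _) (fun x _ => hf.differentiable one_ne_zero x)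
  simpa using h

theorem integral_euclDiv_eq_zero {F : EuclideanSpace ℝ (Fin n) → EuclideanSpace ℝ (Fin n)}
    (hF : ContDiff ℝ 1 F) (hc : HasCompactSupport F) :
    Integrable (euclDiv F) ∧ ∫ x, euclDiv F x = 0 := by
  refine ⟨(continuousOn_univ.1 (continuousOn_euclDiv isOpen_univ
    hF.contDiffOn)).integrable_of_hasCompactSupport (hasCompactSupport_euclDiv hc), ?_⟩
  have hcoord (i : Fin n) : ContDiff ℝ 1 (fun y => F y i) := by fun_prop
  have hcc (i : Fin n) : HasCompactSupport (fun y => F y i) :=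
    hc.comp_left (g := fun v : EuclideanSpace ℝ (Fin n) => v i) rfl
  have he (x : EuclideanSpace ℝ (Fin n)) (i : Fin n) :
      (fderiv ℝ F x (EuclideanSpace.single i 1)) i =
        fderiv ℝ (fun y => F y i) x (EuclideanSpace.single i 1) := by
    have := ((EuclideanSpace.proj i : EuclideanSpace ℝ (Fin n) →L[ℝ] ℝ).hasFDerivAt.comp x
      (hF.differentiable one_ne_zero x).hasFDerivAt).fderiv
    exact (DFunLike.congr_fun this (EuclideanSpace.single i 1)).symm
  simp only [euclDiv, he]
  rw [integral_finsetSum]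
  · exact Finset.sum_eq_zero fun i _ => integral_fderiv_apply_eq_zero _ (hcoord i) (hcc i) _
  · exact fun i _ => (((hcoord i).continuous_fderiv one_ne_zero).clm_apply
      continuous_const).integrable_of_hasCompactSupport ((hcc i).fderiv_apply ℝ _)

end Calculus

/-! ### The vector field, its divergence and the pointwise inequality. -/

section Rellich

variable {n : ℕ} {x : EuclideanSpace ℝ (Fin n)}

theorem mem_unitBall_diff_zero : x ∈ unitBall n \ {0} ↔ 0 < ‖x‖ ∧ ‖x‖ < 1 := by
  simp [unitBall, and_comm]

theorem isOpen_unitBall_diff_zero : IsOpen (unitBall n \ {0}) :=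
  Metric.isOpen_ball.sdiff isClosed_singleton

theorem hypDist_pos (hx : x ∈ unitBall n \ {0}) : 0 < hypDist x := by
  obtain ⟨h0, h1⟩ := mem_unitBall_diff_zero.1 hx
  have := two_mul_le_log_one_add_div_one_sub h0.le h1
  unfold hypDist
  linarith

theorem conformalFactor_pos (hx : x ∈ unitBall n) : 0 < conformalFactor x := by
  have h1 : ‖x‖ < 1 := by simpa [unitBall] using hx
  have : 0 < 1 - ‖x‖ ^ 2 := by nlinarith [norm_nonneg x]
  unfold conformalFactor
  positivity

theorem contDiffAt_hypDist (hx : x ∈ unitBall n \ {0}) : ContDiffAt ℝ ∞ hypDist x := by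
  obtain ⟨h0, h1⟩ := mem_unitBall_diff_zero.1 hx
  have hn : ContDiffAt ℝ ∞ (fun y : EuclideanSpace ℝ (Fin n) => ‖y‖) x :=
    contDiffAt_norm ℝ (norm_pos_iff.1 h0)
  have h2 : 1 - ‖x‖ ≠ 0 := by linarith
  have h3 : 1 + ‖x‖ ≠ 0 := by linarith
  exact ((contDiffAt_const.add hn).div (contDiffAt_const.sub hn) h2).log (div_ne_zero h3 h2)

theorem contDiffAt_conformalFactor (hx : x ∈ unitBall n) : ContDiffAt ℝ ∞ conformalFactor x := by
  have h1 : ‖x‖ < 1 := by simpa [unitBall] using hx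
  have h4 : 1 - ‖x‖ ^ 2 ≠ 0 := by nlinarith [norm_nonneg x]
  exact contDiffAt_const.div (contDiffAt_const.sub (contDiff_norm_sq ℝ).contDiffAt) h4

theorem contDiffAt_hypDist_rpow (hx : x ∈ unitBall n \ {0}) (β : ℝ) :
    ContDiffAt ℝ ∞ (fun y => hypDist y ^ β) x :=
  (contDiffAt_hypDist hx).rpow_const_of_ne (hypDist_pos hx).ne'

theorem contDiffAt_conformalFactor_zpow (hx : x ∈ unitBall n) (m : ℤ) :
    ContDiffAt ℝ ∞ (fun y => conformalFactor y ^ m) x := by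
  have hp := contDiffAt_conformalFactor hx
  obtain ⟨k, rfl | rfl⟩ := m.eq_nat_or_neg
  · simpa using hp.pow k
  · simp only [zpow_neg, zpow_natCast]
    exact (hp.pow k).inv (pow_ne_zero _ (conformalFactor_pos hx).ne')

theorem contDiff_gradient {E : Type*} [NormedAddCommGroup E] [InnerProductSpace ℝ E]
    [CompleteSpace E] {φ : E → ℝ} (hφ : ContDiff ℝ ∞ φ) : ContDiff ℝ ∞ (gradient φ) :=
  (InnerProductSpace.toDual ℝ E).symm.toContinuousLinearEquiv.contDiff.comp
    (hφ.fderiv_right (m := ∞) le_rfl)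

theorem fderiv_hypDist_rpow_apply (hx : x ∈ unitBall n \ {0}) (β : ℝ)
    (v : EuclideanSpace ℝ (Fin n)) :
    fderiv ℝ (fun y => hypDist y ^ β) x v =
      β * hypDist x ^ (β - 1) * conformalFactor x * inner ℝ x v / ‖x‖ := by
  obtain ⟨h0, h1⟩ := mem_unitBall_diff_zero.1 hx
  have hd : Real.log ((1 + ‖x‖) / (1 - ‖x‖)) ≠ 0 := (hypDist_pos hx).ne'
  have h := (hasFDerivAt_comp_norm (norm_pos_iff.1 h0)
    ((hasDerivAt_log_one_add_div_one_sub h0 h1).rpow_const (p := β) (Or.inl hd))).fderiv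
  refine (DFunLike.congr_fun h v).trans ?_
  simp [hypDist, conformalFactor]
  ring

/-- The vector field whose divergence carries the integrations by parts in the weighted Rellich
inequality. -/
noncomputable def rellichField (α : ℝ) (φ : EuclideanSpace ℝ (Fin n) → ℝ) (y : EuclideanSpace ℝ (Fin n)) :
    EuclideanSpace ℝ (Fin n) :=
  (hypDist y ^ (α - 2) * φ y) • (conformalFactor y ^ ((n : ℤ) - 2) • gradient φ y) +
    -- The factor `(n-2)/2` raises the coefficient of the cross term in `φ ⟨x, ∇φ⟩/|x|` from `α-2`
    -- to `n+α-4`, which is what the Hardy square needs.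
    (((n : ℝ) - 2) / 2 * φ y ^ 2 *
      (hypDist y ^ (α - 3) * conformalFactor y ^ ((n : ℤ) - 1) * ‖y‖⁻¹)) • y

variable {φ : EuclideanSpace ℝ (Fin n) → ℝ}

theorem contDiffAt_rellichField (hφ : ContDiff ℝ ∞ φ) (hx : x ∈ unitBall n \ {0}) (α : ℝ) :
    ContDiffAt ℝ ∞ (rellichField α φ) x := by
  obtain ⟨h0, h1⟩ := mem_unitBall_diff_zero.1 hx
  have hn : ContDiffAt ℝ ∞ (fun y : EuclideanSpace ℝ (Fin n) => ‖y‖) x :=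
    contDiffAt_norm ℝ (norm_pos_iff.1 h0)
  exact (((contDiffAt_hypDist_rpow hx _).mul hφ.contDiffAt).smul
    ((contDiffAt_conformalFactor_zpow hx.1 _).smul (contDiff_gradient hφ).contDiffAt)).add
    (((contDiffAt_const.mul (hφ.contDiffAt.pow 2)).mul (((contDiffAt_hypDist_rpow hx _).mul
      (contDiffAt_conformalFactor_zpow hx.1 _)).mul (hn.inv h0.ne'))).smul contDiffAt_id)

theorem tsupport_rellichField_subset (α : ℝ) : tsupport (rellichField α φ) ⊆ tsupport φ :=
  closure_mono fun x hx => by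
    contrapose! hx
    simp only [Function.mem_support, not_not] at hx ⊢
    simp [rellichField, hx]

theorem euclDiv_rellichField (hφ : ContDiff ℝ ∞ φ) (hx : x ∈ unitBall n \ {0}) (α : ℝ) :
    euclDiv (rellichField α φ) x =
      hypDist x ^ (α - 2) * φ x * (conformalFactor x ^ n * hypLaplacian φ x) +
      conformalFactor x ^ ((n : ℤ) - 2) * (hypDist x ^ (α - 2) * ‖gradient φ x‖ ^ 2 +
        φ x * ((α - 2) * hypDist x ^ (α - 3) * conformalFactor x *
          inner ℝ x (gradient φ x) / ‖x‖)) +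
      ((n : ℝ) - 2) / 2 * (2 * φ x * inner ℝ x (gradient φ x) *
          (hypDist x ^ (α - 3) * conformalFactor x ^ ((n : ℤ) - 1) * ‖x‖⁻¹) +
        φ x ^ 2 * (hypDist x ^ (α - 4) * conformalFactor x ^ (n : ℤ) *
          (α - 3 + (n - 1) * (hypDist x * ((1 + ‖x‖ ^ 2) / (2 * ‖x‖)))))) := by
  obtain ⟨h0, h1⟩ := mem_unitBall_diff_zero.1 hx
  have hp := conformalFactor_pos hx.1
  have hd := hypDist_pos hx
  have hD := contDiffAt_hypDist_rpow hx (α - 2)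
  have hH : DifferentiableAt ℝ
      (fun y => conformalFactor y ^ ((n : ℤ) - 2) • gradient φ y) x :=
    ((contDiffAt_conformalFactor_zpow hx.1 ((n : ℤ) - 2)).smul
      (contDiff_gradient hφ).contDiffAt).differentiableAt (by simp)
  have hA : DifferentiableAt ℝ (fun y => hypDist y ^ (α - 2) * φ y) x :=
    (hD.mul hφ.contDiffAt).differentiableAt (by simp)
  have hγ : HasFDerivAt (fun y => hypDist y ^ (α - 3) * conformalFactor y ^ ((n : ℤ) - 1) * ‖y‖⁻¹)
      _ x := hasFDerivAt_comp_norm (norm_pos_iff.1 h0)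
        (show HasDerivAt _ _ ‖x‖ from
          (by ring : α - 4 + 1 = α - 3) ▸ hasDerivAt_radialProfile h0 h1 (α - 4) n)
  have hφd : DifferentiableAt ℝ φ x := hφ.differentiable (by simp) x
  have hφf := hφd.hasFDerivAt
  have hB : HasFDerivAt (fun y => ((n : ℝ) - 2) / 2 * φ y ^ 2 *
      (hypDist y ^ (α - 3) * conformalFactor y ^ ((n : ℤ) - 1) * ‖y‖⁻¹)) _ x := (((hφf.pow 2).const_mul (((n : ℝ) - 2) / 2)).mul hγ)
  have hgrad (v : EuclideanSpace ℝ (Fin n)) : fderiv ℝ φ x v = inner ℝ v (gradient φ x) := by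
    rw [real_inner_comm, inner_gradient_left]
  have hlap : euclDiv (fun y => conformalFactor y ^ ((n : ℤ) - 2) • gradient φ y) x =
      conformalFactor x ^ n * hypLaplacian φ x := by
    rw [hypLaplacian, ← mul_assoc, ← zpow_natCast, ← zpow_add₀ hp.ne']
    simp
  unfold rellichField
  rw [euclDiv_add (hA.fun_smul hH) (hB.differentiableAt.fun_smul differentiableAt_fun_id),
    euclDiv_smul hA hH, hlap,
    euclDiv_smul hB.differentiableAt differentiableAt_fun_id, euclDiv_id, hB.fderiv,
    fderiv_fun_mul (hD.differentiableAt (by simp)) hφd]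
  have e1 : conformalFactor x ^ (n : ℤ) =
      conformalFactor x ^ ((n : ℤ) - 1) * conformalFactor x := by
    rw [← zpow_add_one₀ hp.ne']; congr 1; ring
  have e2 : hypDist x ^ (α - 3) = hypDist x ^ (α - 4) * hypDist x := by
    rw [← Real.rpow_add_one hd.ne']; congr 1; ring
  have e3 : conformalFactor x * (1 - ‖x‖ ^ 2) = 2 := by
    rw [conformalFactor, div_mul_cancel₀]; nlinarith
  have e4 : α - 2 - 1 = α - 3 := by ring
  simp only [add_apply, smul_apply, smul_eq_mul, map_smul, fderiv_hypDist_rpow_apply hx, hgrad,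
    innerSL_apply_apply, real_inner_self_eq_norm_sq, e4]
  have hl : Real.log ((1 + ‖x‖) / (1 - ‖x‖)) = hypDist x := rfl
  have hc : 2 / (1 - ‖x‖ ^ 2) = conformalFactor x := rfl
  rw [hl, hc, e1, e2]
  set d := hypDist x
  set p := conformalFactor x
  set P := p ^ ((n : ℤ) - 1)
  set q := d ^ (α - 4)
  push_cast
  -- A field `γ(|x|) x` has divergence `|x| γ' + n γ`; the two parts combine through `s +
  -- (1-s²)/(2s) = (1+s²)/(2s)`, leaving `(n-1) d coth d`.
  have key : q * P * p * (α - 3 + (n - 1) * d * ‖x‖ - d * ((1 - ‖x‖ ^ 2) / (2 * ‖x‖))) /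
      ‖x‖ / ‖x‖ * ‖x‖ ^ 2 = q * (P * p) * (α - 3 + (n - 1) * (d * ((1 + ‖x‖ ^ 2) / (2 * ‖x‖)))) -
        q * d * P * ‖x‖⁻¹ * n := by
    field_simp
    linear_combination (-n * d * q * P) * e3
  linear_combination ((n : ℝ) - 2) / 2 * φ x ^ 2 * key

/-- The difference of the two sides is exactly the sum of two nonnegative terms: the square `h1`,
and `h2` times the Hardy square `hS`. In the application `q = d^(α-4)`, `Q = p^(n-2)`, `L = Δφ`, `f
= φ`, `m` is the radial derivative, `N = |∇φ|` and `C = d coth d`. -/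
theorem rellich_algebraic_bound {ν α q Q d p L f m N C : ℝ} (hα : α < 2) (hν : 0 < ν + α - 4)
    (hq : 0 ≤ q) (hQ : 0 ≤ Q)
    (hS : 0 ≤ d ^ 2 * N ^ 2 + (ν + α - 4) * d * p * f * m + ((ν + α - 4) / 2) ^ 2 * p ^ 2 * f ^ 2) :
    (ν + α - 4) ^ 2 * (ν - α) ^ 2 / 16 * (Q * p ^ 2 * q * f ^ 2) +
      (ν + α - 4) * (ν - α) / 4 * (ν - 1) * (ν - 2) * (C - 1) * (Q * p ^ 2 * q * f ^ 2) ≤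
    Q * p ^ 2 * (q * d ^ 4) * L ^ 2 + (ν + α - 4) * (ν - α) / 2 *
      (q * d ^ 2 * f * (Q * p ^ 2 * L) +
      Q * (q * d ^ 2 * N ^ 2 + f * ((α - 2) * (q * d) * p * m)) +
      (ν - 2) / 2 * (2 * f * m * (q * d * (Q * p)) +
        f ^ 2 * (q * (Q * p ^ 2) * (α - 3 + (ν - 1) * C)))) := by
  have h1 : 0 ≤ Q * p ^ 2 * q * (d ^ 2 * L + (ν + α - 4) * (ν - α) / 4 * f) ^ 2 := by positivity
  have h2 : 0 ≤ (ν + α - 4) * (ν - α) / 2 * (Q * q) := by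
    have : 0 < ν - α := by linarith
    positivity
  linear_combination h1 + mul_nonneg h2 hS

theorem two_pow_mul_hypDist_pow_four_le (hn : 3 ≤ n) (hx : x ∈ unitBall n \ {0}) :
    2 ^ n * hypDist x ^ 4 ≤ 8 * ((n : ℝ) - 1) * (n - 2) *
      (hypDist x * ((1 + ‖x‖ ^ 2) / (2 * ‖x‖)) - 1) * conformalFactor x ^ n := by
  obtain ⟨h0, h1⟩ := mem_unitBall_diff_zero.1 hx
  have h := log_pow_four_mul_le h0 h1
  have hs : 0 < 1 - ‖x‖ ^ 2 := by nlinarith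
  -- The cubic power in `log_pow_four_mul_le` is the worst case `n = 3`; there too `8 (n-1)(n-2)`
  -- takes its least value `16`.
  have hpow : (1 - ‖x‖ ^ 2) ^ n ≤ (1 - ‖x‖ ^ 2) ^ 3 :=
    pow_le_pow_of_le_one hs.le (by nlinarith) hn
  have hn' : (3 : ℝ) ≤ n := by exact_mod_cast hn
  have hW : 0 ≤ hypDist x * ((1 + ‖x‖ ^ 2) / (2 * ‖x‖)) - 1 := by
    have : 0 ≤ hypDist x ^ 4 * (1 - ‖x‖ ^ 2) ^ 3 := by positivity
    unfold hypDist at *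
    linarith
  have hN : 16 ≤ 8 * ((n : ℝ) - 1) * (n - 2) := by nlinarith
  have hc : conformalFactor x ^ n = 2 ^ n / (1 - ‖x‖ ^ 2) ^ n := by
    rw [conformalFactor, div_pow]
  rw [hc, mul_div_assoc', le_div_iff₀ (by positivity)]
  calc 2 ^ n * hypDist x ^ 4 * (1 - ‖x‖ ^ 2) ^ n
      ≤ 2 ^ n * hypDist x ^ 4 * (1 - ‖x‖ ^ 2) ^ 3 := by gcongr
    _ = 2 ^ n * (hypDist x ^ 4 * (1 - ‖x‖ ^ 2) ^ 3) := by ring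
    _ ≤ 2 ^ n * (16 * (hypDist x * ((1 + ‖x‖ ^ 2) / (2 * ‖x‖)) - 1)) :=
      mul_le_mul_of_nonneg_left h (by positivity)
    _ ≤ 2 ^ n * (8 * ((n : ℝ) - 1) * (n - 2) *
          (hypDist x * ((1 + ‖x‖ ^ 2) / (2 * ‖x‖)) - 1)) := by gcongr
    _ = _ := by ring

theorem rellich_pointwise (hn : 3 ≤ n) {α : ℝ} (hα : α < 2) (hα' : 0 < (n : ℝ) + α - 4)
    (hφ : ContDiff ℝ ∞ φ) (hx : x ∈ unitBall n \ {0}) :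
    ((n : ℝ) + α - 4) ^ 2 * ((n : ℝ) - α) ^ 2 / 16 *
        (conformalFactor x ^ n * (hypDist x ^ (α - 4) * φ x ^ 2)) +
      1 / 4 * (((n : ℝ) + α - 4) * ((n : ℝ) - α) / 8) * 2 ^ n * (hypDist x ^ α * φ x ^ 2) ≤
    conformalFactor x ^ n * (hypDist x ^ α * |hypLaplacian φ x| ^ 2) +
      ((n : ℝ) + α - 4) * (n - α) / 2 * euclDiv (rellichField α φ) x := by
  obtain ⟨h0, h1⟩ := mem_unitBall_diff_zero.1 hx
  have hp := conformalFactor_pos hx.1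
  have hd := hypDist_pos hx
  have hb := two_pow_mul_hypDist_pow_four_le hn hx
  rw [euclDiv_rellichField hφ hx, sq_abs]
  have e1 : conformalFactor x ^ n = conformalFactor x ^ ((n : ℤ) - 2) * conformalFactor x ^ 2 := by
    rw [← zpow_natCast, ← zpow_natCast, ← zpow_add₀ hp.ne']; simp
  have e2 : conformalFactor x ^ ((n : ℤ) - 1) =
      conformalFactor x ^ ((n : ℤ) - 2) * conformalFactor x := by
    rw [← zpow_add_one₀ hp.ne']; congr 1; ring
  have e3 : hypDist x ^ (α - 3) = hypDist x ^ (α - 4) * hypDist x := by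
    rw [← Real.rpow_add_one hd.ne']; congr 1; ring
  have e4 : hypDist x ^ (α - 2) = hypDist x ^ (α - 4) * hypDist x ^ 2 := by
    rw [← Real.rpow_add_natCast hd.ne']; congr 1; push_cast; ring
  have e5 : hypDist x ^ α = hypDist x ^ (α - 4) * hypDist x ^ 4 := by
    rw [← Real.rpow_add_natCast hd.ne']; congr 1; push_cast; ring
  have hS : 0 ≤ hypDist x ^ 2 * ‖gradient φ x‖ ^ 2 + ((n : ℝ) + α - 4) * hypDist x *
      conformalFactor x * φ x * (inner ℝ x (gradient φ x) / ‖x‖) +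
      (((n : ℝ) + α - 4) / 2) ^ 2 * conformalFactor x ^ 2 * φ x ^ 2 := by
    -- The vector vanishes when `φ` behaves like `d^(-(n+α-4)/2)` radially, the virtual extremal of
    -- the Hardy inequality.
    have h := sq_nonneg ‖hypDist x • gradient φ x +
      (((n : ℝ) + α - 4) / 2 * conformalFactor x * φ x / ‖x‖) • x‖
    rw [norm_add_sq_real, norm_smul, norm_smul, inner_smul_left, inner_smul_right, mul_pow,
      mul_pow, Real.norm_eq_abs, Real.norm_eq_abs, sq_abs, sq_abs, real_inner_comm] at h
    refine h.trans_eq ?_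
    simp only [conj_trivial]
    field_simp
  have hmain := rellich_algebraic_bound (L := hypLaplacian φ x)
    (C := hypDist x * ((1 + ‖x‖ ^ 2) / (2 * ‖x‖))) hα hα'
    (Real.rpow_nonneg hd.le (α - 4)) (zpow_nonneg hp.le ((n : ℤ) - 2)) hS
  -- `1/32 = (1/4)(1/8)` is the factor `c` with the denominator of `ε`; multiplied by the `8` in
  -- `hb` it restores the coefficient `1/4` of the curvature term.
  have hcoef : 0 ≤ ((n : ℝ) + α - 4) * (n - α) / 32 * (hypDist x ^ (α - 4) * φ x ^ 2) := by
    have : 0 < (n : ℝ) - α := by linarith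
    have := Real.rpow_nonneg hd.le (α - 4)
    positivity
  have hextra := mul_le_mul_of_nonneg_left hb hcoef
  rw [zpow_natCast, e1, e2, e3, e4, e5]
  rw [e1] at hextra
  linear_combination hmain + hextra

end Rellich

/-! ### Integrability, and reduction of hyperbolic integrals to Lebesgue integrals. -/

section Integration

variable {n : ℕ} {φ : EuclideanSpace ℝ (Fin n) → ℝ}

theorem hypLaplacian_eq_zero_of_notMem_tsupport {x : EuclideanSpace ℝ (Fin n)}
    (hx : x ∉ tsupport φ) : hypLaplacian φ x = 0 := by
  have h : tsupport (fun y => conformalFactor y ^ ((n : ℤ) - 2) • gradient φ y) ⊆ tsupport φ := by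
    refine closure_minimal (fun y hy => ?_) isClosed_closure
    by_contra hc
    simp [gradient, fderiv_of_notMem_tsupport ℝ hc] at hy
  rw [hypLaplacian, euclDiv_eq_zero_of_notMem_tsupport fun hc => hx (h hc), mul_zero]

theorem continuousOn_hypLaplacian (hφ : ContDiff ℝ ∞ φ) :
    ContinuousOn (hypLaplacian φ) (unitBall n) := by
  have hp (m : ℤ) : ContDiffOn ℝ ∞ (fun y => conformalFactor y ^ m) (unitBall n) :=
    fun x hx => (contDiffAt_conformalFactor_zpow hx m).contDiffWithinAt
  exact (hp _).continuousOn.mul (continuousOn_euclDiv Metric.isOpen_ball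
    (((hp _).smul (contDiff_gradient hφ).contDiffOn).of_le (by simp)))

theorem integral_hypVolume {f : EuclideanSpace ℝ (Fin n) → ℝ}
    (hf : Function.support f ⊆ unitBall n) :
    ∫ x, f x ∂(hypVolume n) = ∫ x, conformalFactor x ^ n * f x := by
  have hm : Measurable (fun x : EuclideanSpace ℝ (Fin n) => conformalFactor x ^ n) := by
    unfold conformalFactor; fun_prop
  rw [hypVolume, integral_withDensity_eq_integral_toReal_smul hm.ennreal_ofReal
    (Filter.Eventually.of_forall fun _ => ENNReal.ofReal_lt_top)]
  rw [← setIntegral_eq_integral_of_forall_compl_eq_zero (s := unitBall n)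
    (f := fun x => conformalFactor x ^ n * f x)]
  · refine setIntegral_congr_fun Metric.isOpen_ball.measurableSet fun x hx => ?_
    simp [ENNReal.toReal_ofReal (pow_nonneg (conformalFactor_pos hx).le n)]
  · intro x hx
    rw [Function.notMem_support.1 fun h => hx (hf h), mul_zero]

theorem integrable_of_continuousOn_of_eq_zero {X : Type*} [TopologicalSpace X] [T2Space X]
    [MeasurableSpace X] [OpensMeasurableSpace X] {μ : Measure X} [IsFiniteMeasureOnCompacts μ]
    {f : X → ℝ} {K U : Set X} (hK : IsCompact K) (hU : IsOpen U) (hKU : K ⊆ U)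
    (hf : ContinuousOn f U) (h0 : ∀ x ∉ K, f x = 0) : Integrable f μ := by
  have hs : tsupport f ⊆ K :=
    closure_minimal (fun x hx => by_contra fun h => hx (h0 x h)) hK.isClosed
  exact (continuous_of_tsupport fun x hx => hf.continuousAt (hU.mem_nhds (hKU (hs hx))))
    |>.integrable_of_hasCompactSupport (HasCompactSupport.intro hK h0)

end Integration

theorem weighted_rellich {n : ℕ} {α : ℝ} (hn : 3 ≤ n) (hα : α < 2) (hα' : 0 < (n : ℝ) + α - 4)
    {φ : EuclideanSpace ℝ (Fin n) → ℝ} (hφ : ContDiff ℝ ∞ φ) (hc : HasCompactSupport φ)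
    (hs : tsupport φ ⊆ unitBall n \ {0}) :
    (((n : ℝ) + α - 4) ^ 2 * ((n : ℝ) - α) ^ 2 / 16) *
        (∫ x, hypDist x ^ (α - 4) * φ x ^ 2 ∂(hypVolume n))
      + 1 / 4 * (((n : ℝ) + α - 4) * ((n : ℝ) - α) / 8) * 2 ^ n *
        (∫ x in unitBall n, hypDist x ^ α * φ x ^ 2)
    ≤ ∫ x, hypDist x ^ α * |hypLaplacian φ x| ^ 2 ∂(hypVolume n) := by
  have hz {x} (hx : x ∉ tsupport φ) : φ x = 0 := image_eq_zero_of_notMem_tsupport hx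
  have hlz {x} (hx : x ∉ tsupport φ) := hypLaplacian_eq_zero_of_notMem_tsupport hx
  have hdc (β : ℝ) : ContinuousOn (fun x : EuclideanSpace ℝ (Fin n) => hypDist x ^ β)
      (unitBall n \ {0}) :=
    fun x hx => (contDiffAt_hypDist_rpow hx β).continuousAt.continuousWithinAt
  have hpc : ContinuousOn (fun x : EuclideanSpace ℝ (Fin n) => conformalFactor x ^ n)
      (unitBall n \ {0}) :=
    fun x hx => ((contDiffAt_conformalFactor hx.1).pow n).continuousAt.continuousWithinAt
  have hφc : ContinuousOn (fun x => φ x ^ 2) (unitBall n \ {0}) :=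
    (hφ.continuous.pow 2).continuousOn
  have hlc : ContinuousOn (fun x => |hypLaplacian φ x| ^ 2) (unitBall n \ {0}) :=
    ((continuousOn_hypLaplacian hφ).mono Set.sdiff_subset).abs.pow 2
  have hint {f : EuclideanSpace ℝ (Fin n) → ℝ} (hf : ContinuousOn f (unitBall n \ {0}))
      (h0 : ∀ x ∉ tsupport φ, f x = 0) : Integrable f :=
    integrable_of_continuousOn_of_eq_zero hc.isCompact isOpen_unitBall_diff_zero hs hf h0
  have hsub {f : EuclideanSpace ℝ (Fin n) → ℝ} (h0 : ∀ x ∉ tsupport φ, f x = 0) :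
      Function.support f ⊆ unitBall n :=
    fun x hx => (hs (by_contra fun h => hx (h0 x h))).1
  have hFs := tsupport_rellichField_subset (φ := φ) α
  -- The weights may be singular at the origin and on the unit sphere, but the field vanishes near
  -- every point outside its support.
  have hF : ContDiff ℝ 1 (rellichField α φ) :=
    contDiff_iff_contDiffAt.2 fun x => by
      by_cases hx : x ∈ tsupport (rellichField α φ)
      · exact (contDiffAt_rellichField hφ (hs (hFs hx)) α).of_le (by simp)
      · exact contDiffAt_const.congr_of_eventuallyEq (notMem_tsupport_iff_eventuallyEq.1 hx)
  obtain ⟨hFi, hF0⟩ := integral_euclDiv_eq_zero hF (hc.mono' (subset_closure.trans hFs))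
  have i1 : Integrable (fun x => conformalFactor x ^ n * (hypDist x ^ (α - 4) * φ x ^ 2)) :=
    hint (hpc.mul ((hdc _).mul hφc)) fun x hx => by simp [hz hx]
  have i2 : Integrable (fun x => hypDist x ^ α * φ x ^ 2) :=
    hint ((hdc _).mul hφc) fun x hx => by simp [hz hx]
  have i3 : Integrable (fun x => conformalFactor x ^ n *
      (hypDist x ^ α * |hypLaplacian φ x| ^ 2)) :=
    hint (hpc.mul ((hdc _).mul hlc)) fun x hx => by simp [hlz hx]
  rw [integral_hypVolume (hsub fun x hx => by simp [hz hx]),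
    integral_hypVolume (hsub fun x hx => by simp [hlz hx]),
    setIntegral_eq_integral_of_forall_compl_eq_zero fun x hx => by
      simp [hz fun h => hx (hs h).1],
    ← integral_const_mul, ← integral_const_mul, ← integral_add (i1.const_mul _) (i2.const_mul _),
    -- The divergence, of integral zero, is inserted on the right so that both sides become single
    -- integrals.
    ← add_zero (∫ x, conformalFactor x ^ n * (hypDist x ^ α * |hypLaplacian φ x| ^ 2)),
    ← mul_zero (((n : ℝ) + α - 4) * (n - α) / 2), ← hF0, ← integral_const_mul,
    ← integral_add i3 (hFi.const_mul _)]
  refine integral_mono ((i1.const_mul _).add (i2.const_mul _)) (i3.add (hFi.const_mul _))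
    fun x => ?_
  by_cases hx : x ∈ tsupport φ
  · exact rellich_pointwise hn hα hα' hφ (hs hx)
  · simp [hz hx, hlz hx, euclDiv_eq_zero_of_notMem_tsupport fun h => hx (hFs h)]

end PoincareBall

theorem theorem3p3 :
    ∃ c : ℝ, 0 < c ∧
      ∀ (n : ℕ) (α : ℝ), 3 ≤ n → α < 2 → 0 < (n : ℝ) + α - 4 →
      ∀ φ : EuclideanSpace ℝ (Fin n) → ℝ,
        ContDiff ℝ ∞ φ → HasCompactSupport φ → tsupport φ ⊆ PoincareBall.unitBall n \ {0} →
        (((n : ℝ) + α - 4) ^ 2 * ((n : ℝ) - α) ^ 2 / 16) *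
            (∫ x, PoincareBall.hypDist x ^ (α - 4) * φ x ^ 2 ∂(PoincareBall.hypVolume n))
          + c * (((n : ℝ) + α - 4) * ((n : ℝ) - α) / 8) * 2 ^ n *
            (∫ x in PoincareBall.unitBall n, PoincareBall.hypDist x ^ α * φ x ^ 2)
        ≤ ∫ x, PoincareBall.hypDist x ^ α * |PoincareBall.hypLaplacian φ x| ^ 2
            ∂(PoincareBall.hypVolume n) := by
  exact ⟨1 / 4, by norm_num, fun _ _ hn hα hα' _ hφ hc hs =>
    PoincareBall.weighted_rellich hn hα hα' hφ hc hs⟩
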